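/- A represented space is a set $X$ with a partial surjection $\delta_X :\subseteq \{0,1\}^{\mathbb N} \to X$; a $p$ with $\delta_X(p)=x$ is a name of $x$. A map $f : X \to Y$ between represented spaces is computable if some machine turns every name of every $x\in X$ into a name of $f(x)$, and a point is computable if it has a computable name. $X\times Y$ is represented by pairing names. $\mathcal C(X,Y)$ is the set of functions $f : X\to Y$ that have a name, where $0^n1p$ is a name of $f$ if the $n$-th machine with oracle $p$ computes a realizer of $f$. $\mathbb S=\{\bot,\top\}$ is Sierpiński space, in which $0^{\mathbb N}$ names $\bot$ and every other sequence names $\top$. $\mathcal O(X)$ is the represented space of open subsets of $X$, obtained by identifying $f\in\mathcal C(X,\mathbb S)$ with $f^{-1}(\{\top\})$; closed sets are complements of open sets. The saturation of $A \subseteq X$ is the intersection of all open sets that contain $A$, the closure of $A$ is the intersection of all closed sets that contain $A$. $\mathcal K(X)$ is the space of saturated compact sets, as a subspace of $\mathcal O(\mathcal O(X))$: its elements are the sets $K\subseteq X$ that equal their saturation and for which $\{U\in\mathcal O(X) : K\subseteq U\}$ is an element of $\mathcal O(\mathcal O(X))$, and the names of $K$ are the names of that element. $\mathcal V(X)$ is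 the space of overt sets, as a subspace of $\mathcal O(\mathcal O(X))$: its elements are the sets $A \subseteq X$ that equal their closure and for which $\{U\in\mathcal O(X) : U\cap A\neq\emptyset\}$ is an element of $\mathcal O(\mathcal O(X))$, and the names of $A$ are the names of that element. Let $X$, $Y$ be represented spaces. 1. The maps $\forall : \mathcal O(X\times Y)\times\mathcal K(X)\to\mathcal O(Y)$, $\forall(R,A)=\{y\in Y : \forall x\in A\ (x,y)\in R\}$, and $\exists : \mathcal O(X\times Y)\times\mathcal V(X)\to\mathcal O(Y)$, $\exists(R,A)=\{y\in Y : \exists x\in A\ (x,y)\in R\}$, are well-defined and computable. 2. Suppose that $Y$ contains a computable point, and let $\mathcal S(X)$ be any represented space whose elements are subsets of $X$. If $\forall : \mathcal O(X\times Y)\times\mathcal S(X)\to\mathcal O(Y)$ is well-defined and computable, then saturation is well-defined and computable as a map $\mathcal S(X)\to\mathcal K(X)$. If $\exists : \mathcal O(X\times Y)\times\mathcal S(X)\to\mathcal O(Y)$ is well-defined and computable, then closure is well-defined and computable as a map $\mathcal S(X)\to\mathcal V(X)$. Both implications are equivalences, so that $\mathcal K(X)$ and $\mathcal V(X)$ are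 characterized by the two quantifiers. -/

import Mathlib

/-- Cantor space `{0,1}^ℕ`. -/
abbrev Cantor : Type := ℕ → Bool

namespace Cantor

/-- The pairing `⟨p, q⟩` of two sequences, by interleaving. -/
def pair (p q : Cantor) : Cantor := fun k => if k % 2 = 0 then p (k / 2) else q (k / 2)

/-- The sequence `0ⁿ1p`. -/
def tag (n : ℕ) (p : Cantor) : Cantor :=
  fun k => if k < n then false else if k = n then true else p (k - n - 1)

theorem pair_inj {p q p' q' : Cantor} (h : pair p q = pair p' q') : p = p' ∧ q = q' := by
  constructor
  · funext k
    have := congrFun h (2 * k)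
    simpa [pair] using this
  · funext k
    have := congrFun h (2 * k + 1)
    have e : (2 * k + 1) / 2 = k := by omega
    have e' : (2 * k + 1) % 2 = 1 := by omega
    simpa [pair, e, e'] using this

theorem tag_inj {n n' : ℕ} {p p' : Cantor} (h : tag n p = tag n' p') : n = n' ∧ p = p' := by
  have key : ∀ {a b : ℕ} {r s : Cantor}, tag a r = tag b s → ¬ a < b := by
    intro a b r s hab hlt
    have := congrFun hab a
    simp [tag, hlt] at this
  have hn : n = n' := le_antisymm (not_lt.1 (key h.symm)) (not_lt.1 (key h))
  subst hn
  refine ⟨rfl, funext fun k => ?_⟩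
  have := congrFun h (n + 1 + k)
  have e1 : ¬ n + 1 + k < n := by omega
  have e2 : n + 1 + k ≠ n := by omega
  have e3 : n + 1 + k - n - 1 = k := by omega
  simpa [tag, e1, e2, e3] using this

end Cantor

/-! ### Machines on infinite sequences

A machine is given by a program `c` for a partial recursive function. In order to produce the `k`-th
output digit, the machine reads its infinite input tape from left to right: whenever it has read the
first `m` digits, `c` is run on (the code of) these `m` digits and `k`; the value `0` means `read one
more digit`, the values `1` and `2` mean `print the digit 0` and `print the digit 1`. -/

/-- The machine with program `c` prints the digit `b` in position `k` when run on the input `p`. -/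
def Prints (c : Nat.Partrec.Code) (p : Cantor) (k : ℕ) (b : Bool) : Prop :=
  ∃ m : ℕ,
    b.toNat + 1 ∈ c.eval (Nat.pair (Encodable.encode ((List.range m).map p)) k) ∧
    ∀ i < m, 0 ∈ c.eval (Nat.pair (Encodable.encode ((List.range i).map p)) k)

/-- The machine with program `c`, run on the input `p`, writes the infinite sequence `q`. -/
def Outputs (c : Nat.Partrec.Code) (p q : Cantor) : Prop := ∀ k, Prints c p k (q k)

/-- The program of the `n`-th machine. -/
def machine (n : ℕ) : Nat.Partrec.Code := Denumerable.ofNat Nat.Partrec.Code n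

theorem Prints.unique {c : Nat.Partrec.Code} {p : Cantor} {k : ℕ} {a b : Bool}
    (ha : Prints c p k a) (hb : Prints c p k b) : a = b := by
  obtain ⟨m, h1, h2⟩ := ha
  obtain ⟨m', h1', h2'⟩ := hb
  rcases lt_trichotomy m m' with h | h | h
  · have := Part.mem_unique h1 (h2' m h)
    omega
  · subst h
    have := Part.mem_unique h1 h1'
    cases a <;> cases b <;> simp_all
  · have := Part.mem_unique h1' (h2 m' h)
    omega

theorem Outputs.unique {c : Nat.Partrec.Code} {p q r : Cantor}
    (hq : Outputs c p q) (hr : Outputs c p r) : q = r :=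
  funext fun k => (hq k).unique (hr k)

/-! ### Represented spaces -/

/-- A representation of the set `X`: a partial surjection `δ : ⊆ {0,1}^ℕ → X`, given by its graph;
`δ.Names p x` says that `p ∈ dom δ` and `δ p = x`. A represented space is a type together with a
representation of it. -/
structure CantorRep (X : Type*) where
  Names : Cantor → X → Prop
  functional : ∀ {p x y}, Names p x → Names p y → x = y
  surjective : ∀ x, ∃ p, Names p x

/-- A map between represented spaces is computable if some machine computes a realizer of it. -/
def ComputableMap {X Y : Type*} (δX : CantorRep X) (δY : CantorRep Y) (f : X → Y) : Prop :=
  ∃ c : Nat.Partrec.Code, ∀ p x, δX.Names p x → ∃ q, Outputs c p q ∧ δY.Names q (f x)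

/-- A point of a represented space is computable if it has a computable name. -/
def ComputablePoint {X : Type*} (δX : CantorRep X) (x : X) : Prop :=
  ∃ p : Cantor, Computable p ∧ δX.Names p x

/-- The product of two represented spaces: `⟨p, q⟩` is a name of `(x, y)` if `p` is a name of `x` and
`q` is a name of `y`. -/
def CantorRep.prod {X Y : Type*} (δX : CantorRep X) (δY : CantorRep Y) : CantorRep (X × Y) where
  Names r z := ∃ p q, r = Cantor.pair p q ∧ δX.Names p z.1 ∧ δY.Names q z.2
  functional := by
    rintro _ ⟨x, y⟩ ⟨x', y'⟩ ⟨p, q, rfl, hp, hq⟩ ⟨p', q', h, hp', hq'⟩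
    obtain ⟨rfl, rfl⟩ := Cantor.pair_inj h
    exact Prod.ext (δX.functional hp hp') (δY.functional hq hq')
  surjective := by
    rintro ⟨x, y⟩
    obtain ⟨p, hp⟩ := δX.surjective x
    obtain ⟨q, hq⟩ := δY.surjective y
    exact ⟨_, p, q, rfl, hp, hq⟩

/-- `r = 0ⁿ1p` is a name of the function `f` if the `n`-th machine with oracle `p` computes a realizer
of `f`. The oracle and the input are both presented to the machine, as the pair `⟨p, q⟩`. -/
def NamesFunction {X Y : Type*} (δX : CantorRep X) (δY : CantorRep Y) (r : Cantor) (f : X → Y) :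
    Prop :=
  ∃ n p, r = Cantor.tag n p ∧
    ∀ q x, δX.Names q x → ∃ s, Outputs (machine n) (Cantor.pair p q) s ∧ δY.Names s (f x)

theorem NamesFunction.unique {X Y : Type*} {δX : CantorRep X} {δY : CantorRep Y} {r : Cantor}
    {f g : X → Y} (hf : NamesFunction δX δY r f) (hg : NamesFunction δX δY r g) : f = g := by
  obtain ⟨n, p, rfl, hf⟩ := hf
  obtain ⟨n', p', h, hg⟩ := hg
  obtain ⟨rfl, rfl⟩ := Cantor.tag_inj h
  funext x
  obtain ⟨q, hq⟩ := δX.surjective x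
  obtain ⟨s, hs, hs'⟩ := hf q x hq
  obtain ⟨t, ht, ht'⟩ := hg q x hq
  obtain rfl := hs.unique ht
  exact δY.functional hs' ht'

/-- The underlying set of the function space `𝒞(X, Y)`. -/
def continuousMaps {X Y : Type*} (δX : CantorRep X) (δY : CantorRep Y) : Set (X → Y) :=
  {f | ∃ r, NamesFunction δX δY r f}

/-- The represented space `𝒞(X, Y)`. -/
def functionRep {X Y : Type*} (δX : CantorRep X) (δY : CantorRep Y) :
    CantorRep (continuousMaps δX δY) where
  Names r f := NamesFunction δX δY r f
  functional h h' := Subtype.ext (h.unique h')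
  surjective f := f.2

/-- Sierpiński space: `0^ℕ` is the name of `⊥ = False`, all other sequences are names of
`⊤ = True`. -/
def sierpinskiRep : CantorRep Prop where
  Names p P := P = ∃ n, p n = true
  functional h h' := h.trans h'.symm
  surjective P := by
    by_cases hP : P
    · exact ⟨fun _ => true, by simp [hP]⟩
    · exact ⟨fun _ => false, by simp [hP]⟩

/-! ### Spaces of subsets -/

/-- The open subsets of a represented space: the sets `f⁻¹({⊤})` for `f ∈ 𝒞(X, 𝕊)`. -/
def openSets {X : Type*} (δX : CantorRep X) : Set (Set X) :=
  {U | (fun x => x ∈ U) ∈ continuousMaps δX sierpinskiRep}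

/-- The represented space `𝒪(X)`, obtained by identifying `f ∈ 𝒞(X, 𝕊)` with `f⁻¹({⊤})`. -/
def openRep {X : Type*} (δX : CantorRep X) : CantorRep (openSets δX) where
  Names r U := (functionRep δX sierpinskiRep).Names r ⟨fun x => x ∈ U.1, U.2⟩
  functional h h' := Subtype.ext (NamesFunction.unique h h')
  surjective U := U.2

/-- The saturation of a set: the intersection of all its open supersets. -/
def saturation {X : Type*} (δX : CantorRep X) (A : Set X) : Set X :=
  ⋂ U ∈ {U ∈ openSets δX | A ⊆ U}, U

/-- The closure of a set: the intersection of all its supersets with open complement. -/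
def repClosure {X : Type*} (δX : CantorRep X) (A : Set X) : Set X :=
  ⋂ C ∈ {C : Set X | Cᶜ ∈ openSets δX ∧ A ⊆ C}, C

/-- The set of open supersets of `A`, as a subset of `𝒪(X)`. -/
def containingFamily {X : Type*} (δX : CantorRep X) (A : Set X) : Set (openSets δX) :=
  {U | A ⊆ U.1}

/-- The set of open sets that intersect `A`, as a subset of `𝒪(X)`. -/
def intersectingFamily {X : Type*} (δX : CantorRep X) (A : Set X) : Set (openSets δX) :=
  {U | (A ∩ U.1).Nonempty}

/-- The underlying set of `𝒦(X)`: the saturated sets `K` which are compact in the sense that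
`{U ∈ 𝒪(X) | K ⊆ U}` is an element of `𝒪(𝒪(X))`. -/
def compactSets {X : Type*} (δX : CantorRep X) : Set (Set X) :=
  {K | saturation δX K = K ∧ containingFamily δX K ∈ openSets (openRep δX)}

/-- The represented space `𝒦(X)`: `K` is identified with `{U | K ⊆ U} ∈ 𝒪(𝒪(X))`. -/
def compactRep {X : Type*} (δX : CantorRep X) : CantorRep (compactSets δX) where
  Names r K := (openRep (openRep δX)).Names r ⟨containingFamily δX K.1, K.2.2⟩
  functional {r K L} h h' := by
    have e : containingFamily δX K.1 = containingFamily δX L.1 :=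
      congrArg Subtype.val ((openRep (openRep δX)).functional h h')
    have e' : ∀ U ∈ openSets δX, K.1 ⊆ U ↔ L.1 ⊆ U := fun U hU =>
      Set.ext_iff.1 e ⟨U, hU⟩
    apply Subtype.ext
    rw [← K.2.1, ← L.2.1]
    ext x
    simp only [saturation, Set.mem_iInter, Set.mem_ofPred_eq]
    exact ⟨fun H U hU => H U ⟨hU.1, (e' U hU.1).2 hU.2⟩,
      fun H U hU => H U ⟨hU.1, (e' U hU.1).1 hU.2⟩⟩
  surjective K := (openRep (openRep δX)).surjective ⟨containingFamily δX K.1, K.2.2⟩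

/-- The underlying set of `𝒱(X)`: the closed sets `A` for which `{U ∈ 𝒪(X) | U ∩ A ≠ ∅}` is an
element of `𝒪(𝒪(X))`. -/
def overtSets {X : Type*} (δX : CantorRep X) : Set (Set X) :=
  {A | repClosure δX A = A ∧ intersectingFamily δX A ∈ openSets (openRep δX)}

/-- The represented space `𝒱(X)`: `A` is identified with `{U | U ∩ A ≠ ∅} ∈ 𝒪(𝒪(X))`. -/
def overtRep {X : Type*} (δX : CantorRep X) : CantorRep (overtSets δX) where
  Names r A := (openRep (openRep δX)).Names r ⟨intersectingFamily δX A.1, A.2.2⟩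
  functional {r A B} h h' := by
    have e : intersectingFamily δX A.1 = intersectingFamily δX B.1 :=
      congrArg Subtype.val ((openRep (openRep δX)).functional h h')
    have e' : ∀ C : Set X, Cᶜ ∈ openSets δX → (A.1 ⊆ C ↔ B.1 ⊆ C) := fun C hC => by
      have := Set.ext_iff.1 e ⟨Cᶜ, hC⟩
      simp only [intersectingFamily, Set.mem_ofPred_eq, Set.inter_compl_nonempty_iff] at this
      exact not_iff_not.1 this
    apply Subtype.ext
    rw [← A.2.1, ← B.2.1]
    ext x
    simp only [repClosure, Set.mem_iInter, Set.mem_ofPred_eq]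
    exact ⟨fun H C hC => H C ⟨hC.1, (e' C hC.1).2 hC.2⟩,
      fun H C hC => H C ⟨hC.1, (e' C hC.1).1 hC.2⟩⟩
  surjective A := (openRep (openRep δX)).surjective ⟨intersectingFamily δX A.1, A.2.2⟩

/-- `Φ` is well-defined and computable as a map into the represented space `(𝒯, δT)` of subsets
of `Y`: all its values belong to `𝒯`, and the resulting map is computable. -/
def ComputableInto {Z Y : Type*} (δZ : CantorRep Z) {𝒯 : Set (Set Y)} (δT : CantorRep 𝒯)
    (Φ : Z → Set Y) : Prop :=
  ∃ h : ∀ z, Φ z ∈ 𝒯, ComputableMap δZ δT fun z => ⟨Φ z, h z⟩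

/-- `∀(R, A) = {y | ∀ x ∈ A, (x, y) ∈ R}`. -/
def forallSet {X Y : Type*} (R : Set (X × Y)) (A : Set X) : Set Y := {y | ∀ x ∈ A, (x, y) ∈ R}

/-- `∃(R, A) = {y | ∃ x ∈ A, (x, y) ∈ R}`. -/
def existsSet {X Y : Type*} (R : Set (X × Y)) (A : Set X) : Set Y := {y | ∃ x ∈ A, (x, y) ∈ R}

/-- The map `∀ : 𝒪(X × Y) × 𝒮 → 𝒪(Y)` is computable, for a represented space `𝒮` of subsets
of `X`. -/
def ForallComputable {X Y : Type*} (δX : CantorRep X) (δY : CantorRep Y) {𝒮 : Set (Set X)}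
    (δS : CantorRep 𝒮) : Prop :=
  ComputableInto ((openRep (δX.prod δY)).prod δS) (openRep δY) fun z => forallSet z.1.1 z.2.1

/-- The map `∃ : 𝒪(X × Y) × 𝒮 → 𝒪(Y)` is computable, for a represented space `𝒮` of subsets
of `X`. -/
def ExistsComputable {X Y : Type*} (δX : CantorRep X) (δY : CantorRep Y) {𝒮 : Set (Set X)}
    (δS : CantorRep 𝒮) : Prop :=
  ComputableInto ((openRep (δX.prod δY)).prod δS) (openRep δY) fun z => existsSet z.1.1 z.2.1

/-! ### Finite approximations of machines -/

open Filter
open Nat.Partrec (Code)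

/-! Both quantifiers ask whether a section lies in a family of open sets. With `R_y = {x | (x, y) ∈
R}`, the point `y` is in `∀(R, A)` iff `R_y` is in `containingFamily δX A`, and in `∃(R, A)` iff
`R_y` is in `intersectingFamily δX A`. A name of `R_y` can be computed from names of `R` and `y`,
and membership in an open set is semidecidable; hence a quantifier is computable as soon as the
corresponding family is computable from `A` (`computableInto_sections_mem`).

Conversely, `A ⊆ U` iff a fixed computable point `y₀` is in `∀(U × Y, A)`, and `U` meets `A` iff
`y₀` is in `∃(U × Y, A)`. The cylinder `U × Y` is computable from `U`, so a computable quantifier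
gives back the family (`computableInto_family`).

Saturation does not change the open supersets of a set, and closure does not change the open sets
that it meets. Computing saturation into `𝒦(X)` or closure into `𝒱(X)` is therefore the same as
computing the family.

All of this rests on evaluation (`exists_code_mem`) and currying (`computableInto_openRep`) for
names of open sets. These need composition, pairing and a universal machine, which are obtained by
simulating machines on finite prefixes (`exists_code_outputs`, `exists_code_simulates`). -/

/-- The list of the first `m` digits of `p`. -/
def Cantor.initial (p : Cantor) (m : ℕ) : List Bool := (List.range m).map p

namespace Cantor

@[simp] theorem length_initial (p : Cantor) (m : ℕ) : (p.initial m).length = m := by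
  simp [initial]

theorem take_initial (p : Cantor) {i m : ℕ} (h : i ≤ m) : (p.initial m).take i = p.initial i := by
  simp [initial, ← List.map_take, List.take_range, h]

theorem getElem?_initial (p : Cantor) (m i : ℕ) :
    (p.initial m)[i]? = if i < m then some (p i) else none := by
  by_cases h : i < m <;> simp [initial, h]

theorem getD_initial (p : Cantor) {m i : ℕ} (h : i < m) : (p.initial m).getD i false = p i := by
  rw [List.getD_eq_getElem?_getD, getElem?_initial, if_pos h, Option.getD_some]

end Cantor

/-- The digit encoded by the value of a program: `1` and `2` encode `0` and `1`. -/
def decodeDigit (v : ℕ) : Option Bool :=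
  if v = 1 then some false else if v = 2 then some true else none

theorem decodeDigit_eq_some {v : ℕ} {b : Bool} : decodeDigit v = some b ↔ v = b.toNat + 1 := by
  unfold decodeDigit
  split_ifs <;> cases b <;> simp_all

theorem primrec_decodeDigit : Primrec decodeDigit :=
  .ite (Primrec.eq.comp .id (.const 1)) (.const _)
    (.ite (Primrec.eq.comp .id (.const 2)) (.const _) (.const _))

/-- The value of the program `c` on the first `i` digits of `l` and `k`, if the computation ends
within `l.length` steps. -/
def probe (c : Code) (l : List Bool) (k i : ℕ) : Option ℕ :=
  c.evaln l.length (Nat.pair (Encodable.encode (l.take i)) k)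

/-- The digit that the machine with program `c` prints in position `k`, if it does so having read
digits from `l` only and with at most `l.length` steps in each of its computations. -/
def approx (c : Code) (l : List Bool) (k : ℕ) : Option Bool :=
  (probe c l k ((List.range (l.length + 1)).findIdx fun i => decide (probe c l k i ≠ some 0))).bind
    decodeDigit

theorem primrec_probe :
    Primrec fun a : (Code × List Bool × ℕ) × ℕ => probe a.1.1 a.1.2.1 a.1.2.2 a.2 := by
  have hl : Primrec fun a : (Code × List Bool × ℕ) × ℕ => a.1.2.1 :=
    Primrec.fst.comp (Primrec.snd.comp Primrec.fst)
  exact Code.primrec_evaln.comp <| Primrec.pair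
    (Primrec.pair (Primrec.list_length.comp hl) (Primrec.fst.comp Primrec.fst))
    (Primrec₂.natPair.comp (Primrec.encode.comp (Primrec.list_take.comp Primrec.snd hl))
      (Primrec.snd.comp (Primrec.snd.comp Primrec.fst)))

theorem primrec_approx : Primrec fun a : Code × List Bool × ℕ => approx a.1 a.2.1 a.2.2 := by
  have hidx : Primrec fun a : Code × List Bool × ℕ =>
      (List.range (a.2.1.length + 1)).findIdx fun i => decide (probe a.1 a.2.1 a.2.2 i ≠ some 0) := by
    refine Primrec.list_findIdx (Primrec.list_range.comp (Primrec.succ.comp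
      (Primrec.list_length.comp (Primrec.fst.comp Primrec.snd)))) ?_
    exact (Primrec.eq.comp primrec_probe (Primrec.const (some 0))).not.decide
  exact Primrec.option_bind (primrec_probe.comp (Primrec.pair Primrec.id hidx))
    (primrec_decodeDigit.comp Primrec.snd)

/-- The search in `approx` stops at the first prefix whose bounded computation does not return `0`,
and this is the only prefix at which a machine may print. -/
theorem approx_eq_some {c : Code} {p : Cantor} {M k : ℕ} {b : Bool} :
    approx c (p.initial M) k = some b ↔ ∃ m ≤ M,
      c.evaln M (Nat.pair (Encodable.encode (p.initial m)) k) = some (b.toNat + 1) ∧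
      ∀ i < m, c.evaln M (Nat.pair (Encodable.encode (p.initial i)) k) = some 0 := by
  have hprobe : ∀ i ≤ M, probe c (p.initial M) k i =
      c.evaln M (Nat.pair (Encodable.encode (p.initial i)) k) := fun i hi => by
    simp [probe, p.take_initial hi]
  unfold approx
  rw [Cantor.length_initial]
  constructor
  · generalize hj : (List.range (M + 1)).findIdx _ = j
    intro h
    obtain ⟨v, hv, hb⟩ := Option.bind_eq_some_iff.1 h
    obtain rfl := decodeDigit_eq_some.1 hb
    have hlt : ∀ i < j, i ≤ M → probe c (p.initial M) k i = some 0 := fun i hi hiM => by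
      have := List.not_of_lt_findIdx (hj ▸ hi)
      simpa using this
    -- Beyond `M`, `probe` sees the same full list as at `M`. Its value there would be `0`, which
    -- encodes no digit.
    have hjM : j ≤ M := by
      by_contra! hMj
      have h0 := hlt M hMj le_rfl
      rw [probe, List.take_of_length_le (by simp)] at h0
      rw [probe, List.take_of_length_le (by simpa using hMj.le), h0] at hv
      simp at hv
    exact ⟨j, hjM, (hprobe j hjM).symm.trans hv, fun i hi => (hprobe i (by omega)).symm.trans
      (hlt i hi (by omega))⟩
  · rintro ⟨m, hm, h1, h2⟩
    have : (List.range (M + 1)).findIdx (fun i => decide (probe c (p.initial M) k i ≠ some 0)) = m := by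
      rw [List.findIdx_eq (by simp; omega)]
      refine ⟨by simp [hprobe m hm, h1], fun j hj => ?_⟩
      simp [hprobe j (by omega), h2 j hj]
    rw [this, hprobe m hm, h1]
    exact decodeDigit_eq_some.2 rfl

theorem Prints.of_approx {c : Code} {p : Cantor} {M k : ℕ} {b : Bool}
    (h : approx c (p.initial M) k = some b) : Prints c p k b := by
  obtain ⟨m, -, h1, h2⟩ := approx_eq_some.1 h
  exact ⟨m, Code.evaln_sound h1, fun i hi => Code.evaln_sound (h2 i hi)⟩

/-- Printing a digit involves finitely many halting computations, and `evaln` is monotone in the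
step bound. -/
theorem Prints.eventually_approx {c : Code} {p : Cantor} {k : ℕ} {b : Bool}
    (h : Prints c p k b) : ∀ᶠ M in atTop, approx c (p.initial M) k = some b := by
  have key : ∀ {n x : ℕ}, x ∈ c.eval n → ∀ᶠ M in atTop, c.evaln M n = some x := fun hx => by
    obtain ⟨K, hK⟩ := Code.evaln_complete.1 hx
    filter_upwards [eventually_ge_atTop K] with M hM using Code.evaln_mono hM hK
  obtain ⟨m, h1, h2⟩ := h
  have h2' := ((Set.finite_lt_nat m).eventually_all).2 fun i hi => key (h2 i hi)
  filter_upwards [eventually_ge_atTop m, key h1, h2'] with M hM hM1 hM2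
  exact approx_eq_some.2 ⟨m, hM, hM1, hM2⟩

theorem Outputs.eq_of_approx {c : Code} {p q : Cantor} (h : Outputs c p q) {M k : ℕ} {b : Bool}
    (hb : approx c (p.initial M) k = some b) : b = q k :=
  (Prints.of_approx hb).unique (h k)

/-! ### Building machines from computations on prefixes -/

/-- A computable function that guesses the output digits from the initial segments of the input
is realized by a machine. -/
theorem exists_code_outputs {g : List Bool → ℕ → Option Bool} (hg : Computable₂ g) :
    ∃ c : Code, ∀ p q : Cantor, (∀ k m b, g (p.initial m) k = some b → b = q k) →
      (∀ k, ∃ m, (g (p.initial m) k).isSome) → Outputs c p q := by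
  -- The default `0`, for an invalid code or no guess, is the request to read one more digit; `1`
  -- and `2` print.
  let F : ℕ → ℕ := fun n =>
    (((Encodable.decode (α := List Bool) n.unpair.1).bind fun l => g l n.unpair.2).map
      fun b => bif b then 2 else 1).getD 0
  have hF : Computable F := by
    refine Computable.option_getD (Computable.option_map (Computable.option_bind
      (Computable.decode.comp (Computable.fst.comp Computable.unpair)) ?_) ?_) (Computable.const 0)
    · exact hg.comp Computable.snd (Computable.snd.comp (Computable.unpair.comp Computable.fst))
    · exact Computable.cond Computable.snd (Computable.const 2) (Computable.const 1)
  obtain ⟨c, hc⟩ := Code.exists_code.1 (Partrec.nat_iff.1 hF.partrec)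
  refine ⟨c, fun p q hq hsome k => ?_⟩
  have heval : ∀ m, F (Nat.pair (Encodable.encode (p.initial m)) k) ∈
      c.eval (Nat.pair (Encodable.encode (p.initial m)) k) := fun m => by
    rw [hc]
    exact Part.mem_some _
  -- The machine prints at the shortest prefix that yields a guess.
  refine ⟨Nat.find (hsome k), ?_, fun i hi => ?_⟩
  · obtain ⟨b, hb⟩ := Option.isSome_iff_exists.1 (Nat.find_spec (hsome k))
    have := heval (Nat.find (hsome k))
    obtain rfl := hq k _ _ hb
    simp only [F, Nat.unpair_pair, Encodable.encodek, Option.bind_some, hb] at this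
    revert this
    cases q k <;> exact id
  · have hn := Nat.find_min (hsome k) hi
    rw [Option.not_isSome_iff_eq_none] at hn
    have := heval i
    simp only [F, Nat.unpair_pair, Encodable.encodek, Option.bind_some, hn, Option.map_none,
      Option.getD_none] at this
    exact this

/-- A machine can run a program on a sequence, if it can compute the program and arbitrarily long
initial segments of that sequence. -/
theorem exists_code_simulates {G : List Bool → Option (Code × List Bool)} (hG : Computable G) :
    ∃ e : Code, ∀ (p : Cantor) (d : Code) (q r : Cantor),
      (∀ m x, G (p.initial m) = some x → ∃ n, x = (d, q.initial n)) →
      (∀ N, ∃ m, ∃ n ≥ N, G (p.initial m) = some (d, q.initial n)) →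
      Outputs d q r → Outputs e p r := by
  have hg : Computable₂ fun l k => (G l).bind fun x => approx x.1 x.2 k := by
    have h : Computable₂ fun (a : List Bool × ℕ) (x : Code × List Bool) => approx x.1 x.2 a.2 :=
      (primrec_approx.comp (Primrec.pair (Primrec.fst.comp Primrec.snd) (Primrec.pair
        (Primrec.snd.comp Primrec.snd) (Primrec.snd.comp Primrec.fst)))).to_comp
    exact Computable.option_bind (hG.comp Computable.fst) h
  obtain ⟨e, he⟩ := exists_code_outputs hg
  refine ⟨e, fun p d q r hsound hcomplete hr => he p r (fun k m b hb => ?_) fun k => ?_⟩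
  · obtain ⟨x, hx, hxb⟩ := Option.bind_eq_some_iff.1 hb
    obtain ⟨n, rfl⟩ := hsound m x hx
    exact hr.eq_of_approx hxb
  · obtain ⟨N, hN⟩ := eventually_atTop.1 (hr k).eventually_approx
    obtain ⟨m, n, hn, hm⟩ := hcomplete N
    exact ⟨m, by simp [hm, hN n hn]⟩

/-- The initial segment of the output that the machine with program `c` is known to write on an
input that begins with `l`. -/
def outputPrefix (c : Code) (l : List Bool) : List Bool :=
  (List.range ((List.range l.length).findIdx fun i => !(approx c l i).isSome)).map
    fun i => (approx c l i).getD false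

theorem primrec_outputPrefix (c : Code) : Primrec (outputPrefix c) := by
  have h : Primrec₂ fun l i => approx c l i :=
    primrec_approx.comp (Primrec.pair (Primrec.const c) (Primrec.pair Primrec.fst Primrec.snd))
  refine Primrec.list_map (Primrec.list_range.comp
    (Primrec.list_findIdx (Primrec.list_range.comp Primrec.list_length) ?_)) ?_
  · exact Primrec.not.comp (Primrec.option_isSome.comp h)
  · exact Primrec.option_getD.comp h (Primrec.const false)

/-- Every position before the first undetermined one has a digit confirmed by `approx`, so the
default `false` in `outputPrefix` never appears. -/
theorem Outputs.outputPrefix_eq {c : Code} {p q : Cantor} (h : Outputs c p q) (M : ℕ) :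
    outputPrefix c (p.initial M) = q.initial
      ((List.range M).findIdx fun i => !(approx c (p.initial M) i).isSome) := by
  rw [outputPrefix, Cantor.length_initial, Cantor.initial]
  refine List.map_congr_left fun i hi => ?_
  have := List.not_of_lt_findIdx (List.mem_range.1 hi)
  simp only [List.getElem_range, Bool.not_eq_false'] at this
  obtain ⟨b, hb⟩ := Option.isSome_iff_exists.1 this
  rw [hb, Option.getD_some, h.eq_of_approx hb]

theorem Outputs.exists_outputPrefix {c : Code} {p q : Cantor} (h : Outputs c p q) (N : ℕ) :
    ∃ m, ∃ n ≥ N, outputPrefix c (p.initial m) = q.initial n := by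
  -- For large `M` the first `N` digits are all determined, so the first undetermined position is at
  -- least `N`.
  have hN := ((Set.finite_lt_nat N).eventually_all).2 fun i _ => (h i).eventually_approx
  obtain ⟨M, hM, hNM⟩ := (hN.and (eventually_ge_atTop N)).exists
  refine ⟨M, _, ?_, h.outputPrefix_eq M⟩
  by_contra! hlt
  have := List.findIdx_getElem (w := hlt.trans_le (by simpa using hNM))
  rw [List.getElem_range, hM _ hlt] at this
  exact Bool.noConfusion this

/-! ### Composition, pairing, elementary machines and a universal machine -/

namespace Machine

/-- Composition of machines. -/
theorem exists_outputs_comp (c d : Code) :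
    ∃ e : Code, ∀ p q r, Outputs c p q → Outputs d q r → Outputs e p r := by
  have hG : Computable fun l => some (d, outputPrefix c l) :=
    Computable.option_some.comp
      (Computable.pair (Computable.const d) (primrec_outputPrefix c).to_comp)
  obtain ⟨e, he⟩ := exists_code_simulates hG
  refine ⟨e, fun p q r hq hr => he p d q r (fun m x hx => ?_) (fun N => ?_) hr⟩
  · obtain rfl := Option.some.inj hx
    exact ⟨_, by rw [hq.outputPrefix_eq]⟩
  · obtain ⟨m, n, hn, h⟩ := hq.exists_outputPrefix N
    exact ⟨m, n, hn, by rw [h]⟩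

/-- Two machines with the same input can be run in parallel. -/
theorem exists_outputs_pair (c d : Code) : ∃ e : Code, ∀ p q r, Outputs c p q → Outputs d p r →
    Outputs e p (Cantor.pair q r) := by
  have h : ∀ c, Computable₂ fun l k => approx c l (k / 2) := fun c =>
    (primrec_approx.comp (Primrec.pair (Primrec.const c) (Primrec.pair Primrec.fst
      (Primrec.nat_div.comp Primrec.snd (Primrec.const 2))))).to_comp
  have hg : Computable₂ fun l k =>
      bif k % 2 == 0 then approx c l (k / 2) else approx d l (k / 2) :=
    Computable.cond (Primrec.beq.comp (Primrec.nat_mod.comp Primrec.snd (Primrec.const 2))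
      (Primrec.const 0)).to_comp (h c) (h d)
  obtain ⟨e, he⟩ := exists_code_outputs hg
  refine ⟨e, fun p q r hq hr => he p _ (fun k m b hb => ?_) fun k => ?_⟩
  · by_cases hk : k % 2 = 0
    · simp only [hk, beq_self_eq_true, cond_true] at hb
      simp [Cantor.pair, hk, hq.eq_of_approx hb]
    · simp only [beq_false_of_ne hk, cond_false] at hb
      simp [Cantor.pair, hk, hr.eq_of_approx hb]
  · obtain ⟨m, h1, h2⟩ :=
      ((hq (k / 2)).eventually_approx.and (hr (k / 2)).eventually_approx).exists
    refine ⟨m, ?_⟩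
    by_cases hk : k % 2 = 0
    · simp [hk, h1]
    · simp [beq_false_of_ne hk, h2]

/-- Some machine rearranges the digits of its input according to a computable function. -/
theorem exists_outputs_reindex {f : ℕ → ℕ} (hf : Computable f) :
    ∃ c : Code, ∀ p : Cantor, Outputs c p (p ∘ f) := by
  have hg : Computable₂ fun (l : List Bool) k => l[f k]? :=
    Computable.list_getElem?.comp Computable.fst (hf.comp Computable.snd)
  obtain ⟨c, hc⟩ := exists_code_outputs hg
  refine ⟨c, fun p => hc p _ (fun k m b hb => ?_) fun k => ⟨f k + 1, ?_⟩⟩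
  · rw [Cantor.getElem?_initial] at hb
    split_ifs at hb
    exact (Option.some.inj hb).symm
  · simp

theorem exists_outputs_self : ∃ c : Code, ∀ p, Outputs c p p := by
  obtain ⟨c, hc⟩ := Machine.exists_outputs_reindex Computable.id
  exact ⟨c, hc⟩

theorem exists_outputs_fst : ∃ c : Code, ∀ p q, Outputs c (Cantor.pair p q) p := by
  obtain ⟨c, hc⟩ := exists_outputs_reindex
    (Primrec.nat_mul.comp (Primrec.const 2) Primrec.id).to_comp
  refine ⟨c, fun p q => ?_⟩
  convert hc (Cantor.pair p q) using 1
  funext k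
  simp [Cantor.pair]

theorem exists_outputs_snd : ∃ c : Code, ∀ p q, Outputs c (Cantor.pair p q) q := by
  obtain ⟨c, hc⟩ := exists_outputs_reindex
    (Primrec.succ.comp (Primrec.nat_mul.comp (Primrec.const 2) Primrec.id)).to_comp
  refine ⟨c, fun p q => ?_⟩
  convert hc (Cantor.pair p q) using 1
  funext k
  have e : (2 * k + 1) / 2 = k := by omega
  simp [Cantor.pair, e]

theorem exists_outputs_const {q : Cantor} (hq : Computable q) :
    ∃ c : Code, ∀ p, Outputs c p q := by
  have hg : Computable₂ fun (_ : List Bool) k => some (q k) :=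
    Computable.option_some.comp (hq.comp Computable.snd)
  obtain ⟨c, hc⟩ := exists_code_outputs hg
  exact ⟨c, fun p => hc p q (fun k m b hb => (Option.some.inj hb).symm) fun k => ⟨0, rfl⟩⟩

theorem exists_outputs_tag (n : ℕ) : ∃ c : Code, ∀ p, Outputs c p (Cantor.tag n p) := by
  have hg : Computable₂ fun (l : List Bool) k =>
      if k < n then some false else if k = n then some true else l[k - n - 1]? := by
    refine Primrec.to_comp (Primrec.ite (Primrec.nat_lt.comp Primrec.snd (Primrec.const n))
      (Primrec.const _) (Primrec.ite (Primrec.eq.comp Primrec.snd (Primrec.const n))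
      (Primrec.const _) (Primrec.list_getElem?.comp Primrec.fst ?_)))
    exact Primrec.nat_sub.comp (Primrec.nat_sub.comp Primrec.snd (Primrec.const n))
      (Primrec.const 1)
  obtain ⟨c, hc⟩ := exists_code_outputs hg
  refine ⟨c, fun p => hc p _ (fun k m b hb => ?_) fun k => ⟨k - n, ?_⟩⟩
  · unfold Cantor.tag
    rw [Cantor.getElem?_initial] at hb
    by_cases h1 : k < n
    · rw [if_pos h1] at hb ⊢
      exact (Option.some.inj hb).symm
    · rw [if_neg h1] at hb ⊢
      by_cases h2 : k = n
      · rw [if_pos h2] at hb ⊢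
        exact (Option.some.inj hb).symm
      · rw [if_neg h2] at hb ⊢
        split_ifs at hb
        exact (Option.some.inj hb).symm
  · rw [Cantor.getElem?_initial]
    split_ifs <;> first | rfl | omega

/-- A universal machine. -/
theorem exists_outputs_universal : ∃ c : Code, ∀ n p q r,
    Outputs (machine n) (Cantor.pair p q) r → Outputs c (Cantor.pair (Cantor.tag n p) q) r := by
  -- The tag occupies the even positions. Deleting its `n + 1` leading digits shifts these positions
  -- by `2 * (n + 1)` and leaves the odd ones in place. `rest` is cut short so that shifted
  -- positions stay within `l`.
  let idx : List Bool → ℕ := fun l =>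
    (List.range l.length).findIdx fun i => l.getD (2 * i) false
  let rest : List Bool → List Bool := fun l => (List.range (l.length - 2 * (idx l + 1))).map
    fun j => l.getD (if j % 2 = 0 then j + 2 * (idx l + 1) else j) false
  let G : List Bool → Option (Code × List Bool) := fun l =>
    if l.getD (2 * idx l) false then some (machine (idx l), rest l) else none
  have hmul : ∀ {α : Type} [Primcodable α] {f : α → ℕ}, Primrec f → Primrec fun a => 2 * f a :=
    fun hf => Primrec.nat_mul.comp (Primrec.const 2) hf
  have hidx : Primrec idx := Primrec.list_findIdx (Primrec.list_range.comp Primrec.list_length)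
    ((Primrec.list_getD false).comp Primrec.fst (hmul Primrec.snd))
  have hshift : Primrec fun l => 2 * (idx l + 1) := hmul (Primrec.succ.comp hidx)
  have hrest : Primrec rest := by
    refine Primrec.list_map (Primrec.list_range.comp
      (Primrec.nat_sub.comp Primrec.list_length hshift))
      ((Primrec.list_getD false).comp Primrec.fst (Primrec.ite ?_ ?_ Primrec.snd))
    · exact Primrec.eq.comp (Primrec.nat_mod.comp Primrec.snd (Primrec.const 2)) (Primrec.const 0)
    · exact Primrec.nat_add.comp Primrec.snd (hshift.comp Primrec.fst)
  have hG : Computable G := by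
    refine (Primrec.ite ?_ (Primrec.option_some.comp (Primrec.pair
      ((Primrec.ofNat Code).comp hidx) hrest)) (Primrec.const none)).to_comp
    exact Primrec.eq.comp ((Primrec.list_getD false).comp Primrec.id (hmul hidx))
      (Primrec.const true)
  obtain ⟨c, hc⟩ := exists_code_simulates hG
  refine ⟨c, fun n p q r hr => ?_⟩
  set u := Cantor.pair (Cantor.tag n p) q with hu
  have heven : ∀ i, u (2 * i) = Cantor.tag n p i := fun i => by simp [hu, Cantor.pair]
  have htag : ∀ i < n, u (2 * i) = false := fun i hi => by simp [heven, Cantor.tag, hi]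
  have htag' : u (2 * n) = true := by simp [heven, Cantor.tag]
  have hidx_eq : ∀ m, 2 * n < m → idx (u.initial m) = n := fun m hm => by
    simp only [idx, Cantor.length_initial]
    rw [List.findIdx_eq (by simp; omega)]
    simp only [List.getElem_range]
    exact ⟨by rw [Cantor.getD_initial _ hm, htag'],
      fun j hj => by rw [Cantor.getD_initial _ (by omega), htag j hj]⟩
  have hrest_eq : ∀ m, idx (u.initial m) = n →
      rest (u.initial m) = (Cantor.pair p q).initial (m - 2 * (n + 1)) := fun m hm => by
    simp only [rest, hm, Cantor.length_initial]
    refine List.map_congr_left fun j hj => ?_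
    have hj := List.mem_range.1 hj
    split_ifs with h
    · rw [Cantor.getD_initial _ (by omega)]
      have e : j + 2 * (n + 1) = 2 * (j / 2 + n + 1) := by omega
      have e1 : ¬ j / 2 + n + 1 < n := by omega
      have e2 : j / 2 + n + 1 ≠ n := by omega
      have e3 : j / 2 + n + 1 - n - 1 = j / 2 := by omega
      rw [e, heven]
      simp [Cantor.tag, Cantor.pair, h, e1, e2, e3]
    · rw [Cantor.getD_initial _ (by omega)]
      simp [hu, Cantor.pair, h]
  refine hc u (machine n) (Cantor.pair p q) r (fun m x hx => ?_) (fun N => ?_) hr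
  · simp only [G] at hx
    split_ifs at hx with h
    have hm : 2 * idx (u.initial m) < m := by
      by_contra! hle
      rw [List.getD_eq_getElem?_getD, Cantor.getElem?_initial, if_neg hle.not_gt] at h
      exact Bool.noConfusion h
    rw [Cantor.getD_initial _ hm] at h
    have hn : idx (u.initial m) = n := by
      by_cases hnm : 2 * n < m
      · exact hidx_eq m hnm
      · rw [htag _ (by omega)] at h
        exact Bool.noConfusion h
    exact ⟨_, by rw [← Option.some.inj hx, hn, hrest_eq m hn]⟩
  · refine ⟨N + 2 * (n + 1), N, le_rfl, ?_⟩
    have hn := hidx_eq (N + 2 * (n + 1)) (by omega)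
    simp only [G]
    rw [hrest_eq _ hn, hn, Cantor.getD_initial _ (by omega), htag', Nat.add_sub_cancel]
    rfl

end Machine

/-! ### Functionals computed by machines -/

theorem exists_machine_eq (c : Code) : ∃ n, machine n = c :=
  ⟨Encodable.encode c, Denumerable.ofNat_encode c⟩

theorem openRep_names_tag {X : Type*} {δX : CantorRep X} {n : ℕ} {p : Cantor} {U : openSets δX} :
    (openRep δX).Names (Cantor.tag n p) U ↔ ∀ q x, δX.Names q x →
      ∃ s, Outputs (machine n) (Cantor.pair p q) s ∧ sierpinskiRep.Names s (x ∈ U.1) := by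
  constructor
  · rintro ⟨n', p', h, H⟩
    obtain ⟨rfl, rfl⟩ := Cantor.tag_inj h
    exact H
  · exact fun H => ⟨n, p, rfl, H⟩

theorem mem_openSets_of_tag {X : Type*} {δX : CantorRep X} (n : ℕ) (p : Cantor) {U : Set X}
    (h : ∀ q x, δX.Names q x →
      ∃ s, Outputs (machine n) (Cantor.pair p q) s ∧ sierpinskiRep.Names s (x ∈ U)) :
    U ∈ openSets δX :=
  ⟨Cantor.tag n p, n, p, rfl, h⟩

/-- Membership of a point in an open set is semidecidable, uniformly in both. -/
theorem exists_code_mem : ∃ e : Code, ∀ {X : Type*} (δX : CantorRep X) (r q : Cantor)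
    (U : openSets δX) (x : X), (openRep δX).Names r U → δX.Names q x →
      ∃ s, Outputs e (Cantor.pair r q) s ∧ sierpinskiRep.Names s (x ∈ U.1) := by
  obtain ⟨e, he⟩ := Machine.exists_outputs_universal
  refine ⟨e, fun δX r q U x hr hq => ?_⟩
  obtain ⟨n, p, rfl, H⟩ := hr
  obtain ⟨s, hs, hs'⟩ := H q x hq
  exact ⟨s, he _ _ _ _ hs, hs'⟩

/-- If membership in `Φ z` is semidecidable, uniformly in `z`, then `Φ` is computable as a map into
the space of open sets. -/
theorem computableInto_openRep {Z Y : Type*} {δZ : CantorRep Z} {δY : CantorRep Y}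
    {Φ : Z → Set Y} (c : Code) (hc : ∀ p q z y, δZ.Names p z → δY.Names q y →
      ∃ s, Outputs c (Cantor.pair p q) s ∧ sierpinskiRep.Names s (y ∈ Φ z)) :
    ComputableInto δZ (openRep δY) Φ := by
  obtain ⟨n, rfl⟩ := exists_machine_eq c
  obtain ⟨t, ht⟩ := Machine.exists_outputs_tag n
  refine ⟨fun z => ?_, t, fun p z hp => ⟨_, ht p, ?_⟩⟩
  · obtain ⟨p, hp⟩ := δZ.surjective z
    exact mem_openSets_of_tag n p fun q y hq => hc p q z y hp hq
  · exact openRep_names_tag.2 fun q y hq => hc p q z y hp hq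

/-- The section `{x | (x, y) ∈ R}` is open, uniformly in the open set `R` and the point `y`. -/
theorem computableInto_section {X Y : Type*} (δX : CantorRep X) (δY : CantorRep Y) :
    ComputableInto ((openRep (δX.prod δY)).prod δY) (openRep δX)
      fun z => {x | (x, z.2) ∈ z.1.1} := by
  -- `b` turns `⟨⟨r, q⟩, s⟩` into `⟨r, ⟨s, q⟩⟩`, the input on which `e` tests `(x, y) ∈ R`.
  obtain ⟨f, hf⟩ := Machine.exists_outputs_fst
  obtain ⟨g, hg⟩ := Machine.exists_outputs_snd
  obtain ⟨ff, hff⟩ := Machine.exists_outputs_comp f f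
  obtain ⟨gf, hgf⟩ := Machine.exists_outputs_comp f g
  obtain ⟨a, ha⟩ := Machine.exists_outputs_pair g gf
  obtain ⟨b, hb⟩ := Machine.exists_outputs_pair ff a
  obtain ⟨e, he⟩ := exists_code_mem
  obtain ⟨c, hc⟩ := Machine.exists_outputs_comp b e
  refine computableInto_openRep c ?_
  rintro _ s ⟨R, y⟩ x ⟨r, q, rfl, hr, hq⟩ hs
  obtain ⟨t, ht, ht'⟩ := he (δX.prod δY) r (Cantor.pair s q) R (x, y) hr ⟨s, q, rfl, hs, hq⟩
  refine ⟨t, hc _ _ _ ?_ ht, ht'⟩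
  exact hb _ _ _ (hff _ _ _ (hf _ _) (hf _ _))
    (ha _ _ _ (hg _ _) (hgf _ _ _ (hf _ _) (hg _ _)))

theorem section_mem_openSets {X Y : Type*} {δX : CantorRep X} {δY : CantorRep Y}
    (R : openSets (δX.prod δY)) (y : Y) : {x | (x, y) ∈ R.1} ∈ openSets δX :=
  (computableInto_section δX δY).1 (R, y)

/-- The set of those `y` for which the section of `R` at `y` belongs to `𝓕` is open, uniformly in
the open set `R` and the open family `𝓕`. -/
theorem computableInto_sections_mem {X Y Z : Type*} {δX : CantorRep X} {δY : CantorRep Y}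
    {δZ : CantorRep Z} {𝓕 : Z → openSets (openRep δX)}
    (h𝓕 : ComputableMap δZ (openRep (openRep δX)) 𝓕) :
    ComputableInto ((openRep (δX.prod δY)).prod δZ) (openRep δY)
      fun z => {y | ⟨_, section_mem_openSets z.1 y⟩ ∈ (𝓕 z.2).1} := by
  -- On input `⟨⟨r, p⟩, q⟩`, `a` computes a name of `𝓕 z` from `p`, `d` a name of the section from
  -- `⟨r, q⟩`, and `e` tests membership.
  obtain ⟨f, hf⟩ := Machine.exists_outputs_fst
  obtain ⟨g, hg⟩ := Machine.exists_outputs_snd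
  obtain ⟨ff, hff⟩ := Machine.exists_outputs_comp f f
  obtain ⟨gf, hgf⟩ := Machine.exists_outputs_comp f g
  obtain ⟨k, hk⟩ := h𝓕
  obtain ⟨a, ha⟩ := Machine.exists_outputs_comp gf k
  obtain ⟨_, σ, hσ⟩ := computableInto_section δX δY
  obtain ⟨b, hb⟩ := Machine.exists_outputs_pair ff g
  obtain ⟨d, hd⟩ := Machine.exists_outputs_comp b σ
  obtain ⟨m, hm⟩ := Machine.exists_outputs_pair a d
  obtain ⟨e, he⟩ := exists_code_mem
  obtain ⟨c, hc⟩ := Machine.exists_outputs_comp m e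
  refine computableInto_openRep c ?_
  rintro _ q ⟨R, z⟩ y ⟨r, p, rfl, hr, hp⟩ hq
  obtain ⟨u, hu, hu'⟩ := hσ (Cantor.pair r q) (R, y) ⟨r, q, rfl, hr, hq⟩
  obtain ⟨v, hv, hv'⟩ := hk p z hp
  obtain ⟨s, hs, hs'⟩ := he (openRep δX) v u (𝓕 z) _ hv' hu'
  refine ⟨s, hc _ _ _ (hm _ _ _ ?_ ?_) hs, hs'⟩
  · exact ha _ _ _ (hgf _ _ _ (hf _ _) (hg _ _)) hv
  · exact hd _ _ _ (hb _ _ _ (hff _ _ _ (hf _ _) (hf _ _)) (hg _ _)) hu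

/-- The cylinder `U × Y` is open, uniformly in the open set `U`. -/
theorem computableInto_cylinder {X Y : Type*} (δX : CantorRep X) (δY : CantorRep Y) :
    ComputableInto (openRep δX) (openRep (δX.prod δY)) fun U => {w | w.1 ∈ U.1} := by
  obtain ⟨f, hf⟩ := Machine.exists_outputs_fst
  obtain ⟨g, hg⟩ := Machine.exists_outputs_snd
  obtain ⟨fg, hfg⟩ := Machine.exists_outputs_comp g f
  obtain ⟨a, ha⟩ := Machine.exists_outputs_pair f fg
  obtain ⟨e, he⟩ := exists_code_mem
  obtain ⟨c, hc⟩ := Machine.exists_outputs_comp a e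
  refine computableInto_openRep c ?_
  rintro r _ U ⟨x, y⟩ hr ⟨p, q, rfl, hp, hq⟩
  obtain ⟨s, hs, hs'⟩ := he δX r p U x hr hp
  exact ⟨s, hc _ _ _ (ha _ _ _ (hf _ _) (hfg _ _ _ (hg _ _) (hf _ _))) hs, hs'⟩

/-- If `Φ` is computable and membership of `y₀` in `Φ (U × Y, z)` says that `U` belongs to `𝓕 z`,
for a computable point `y₀`, then `𝓕` is computable as a map into `𝒪(𝒪(X))`. -/
theorem computableInto_family {X Y Z : Type*} {δX : CantorRep X} {δY : CantorRep Y}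
    {δZ : CantorRep Z} {Φ : openSets (δX.prod δY) × Z → Set Y} {𝓕 : Z → Set (openSets δX)}
    (hΦ : ComputableInto ((openRep (δX.prod δY)).prod δZ) (openRep δY) Φ)
    {y₀ : Y} (hy₀ : ComputablePoint δY y₀)
    (h : ∀ (z : Z) (U : openSets δX) (R : openSets (δX.prod δY)), R.1 = {w | w.1 ∈ U.1} →
      (U ∈ 𝓕 z ↔ y₀ ∈ Φ (R, z))) :
    ComputableInto δZ (openRep (openRep δX)) 𝓕 := by
  obtain ⟨q₀, hq₀, hq₀'⟩ := hy₀
  obtain ⟨hΦo, φ, hφ⟩ := hΦ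
  obtain ⟨hR, κ, hκ⟩ := computableInto_cylinder δX δY
  -- On input `⟨p, u⟩`, `d` computes a name of `Φ (U × Y, z)`, and `e` tests it against the constant
  -- name `q₀` of `y₀`.
  obtain ⟨f, hf⟩ := Machine.exists_outputs_fst
  obtain ⟨g, hg⟩ := Machine.exists_outputs_snd
  obtain ⟨k, hk⟩ := Machine.exists_outputs_const hq₀
  obtain ⟨a, ha⟩ := Machine.exists_outputs_comp g κ
  obtain ⟨b, hb⟩ := Machine.exists_outputs_pair a f
  obtain ⟨d, hd⟩ := Machine.exists_outputs_comp b φ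
  obtain ⟨m, hm⟩ := Machine.exists_outputs_pair d k
  obtain ⟨e, he⟩ := exists_code_mem
  obtain ⟨c, hc⟩ := Machine.exists_outputs_comp m e
  refine computableInto_openRep c fun p u z U hp hu => ?_
  obtain ⟨v, hv, hv'⟩ := hκ u U hu
  obtain ⟨w, hw, hw'⟩ := hφ (Cantor.pair v p) (⟨_, hR U⟩, z) ⟨v, p, rfl, hv', hp⟩
  obtain ⟨s, hs, hs'⟩ := he δY w q₀ _ y₀ hw' hq₀'
  refine ⟨s, hc _ _ _ (hm _ _ _ (hd _ _ _ (hb _ _ _ (ha _ _ _ (hg _ _) hv) (hf _ _)) hw)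
    (hk _)) hs, ?_⟩
  rwa [h z U ⟨_, hR U⟩ rfl]

/-! ### Saturation and closure -/

theorem saturation_subset_iff {X : Type*} {δX : CantorRep X} {A U : Set X}
    (hU : U ∈ openSets δX) : saturation δX A ⊆ U ↔ A ⊆ U :=
  ⟨fun h => (Set.subset_iInter₂ fun _ hV => hV.2).trans h,
    fun h => Set.biInter_subset_of_mem (show U ∈ {U ∈ openSets δX | A ⊆ U} from ⟨hU, h⟩)⟩

theorem repClosure_subset_iff {X : Type*} {δX : CantorRep X} {A C : Set X}
    (hC : Cᶜ ∈ openSets δX) : repClosure δX A ⊆ C ↔ A ⊆ C :=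
  ⟨fun h => (Set.subset_iInter₂ fun _ hV => hV.2).trans h,
    fun h => Set.biInter_subset_of_mem
      (show C ∈ {C : Set X | Cᶜ ∈ openSets δX ∧ A ⊆ C} from ⟨hC, h⟩)⟩

/-- A set misses `U` iff it is contained in the closed set `Uᶜ`. -/
theorem repClosure_inter_nonempty_iff {X : Type*} {δX : CantorRep X} {A U : Set X}
    (hU : U ∈ openSets δX) : (repClosure δX A ∩ U).Nonempty ↔ (A ∩ U).Nonempty := by
  have := repClosure_subset_iff (δX := δX) (A := A) (C := Uᶜ) (by rwa [compl_compl])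
  rw [← not_iff_not]
  simpa only [Set.not_nonempty_iff_eq_empty, ← Set.disjoint_iff_inter_eq_empty,
    ← Set.subset_compl_iff_disjoint_right] using this

theorem saturation_saturation {X : Type*} (δX : CantorRep X) (A : Set X) :
    saturation δX (saturation δX A) = saturation δX A :=
  Set.Subset.antisymm
    (Set.subset_iInter₂ fun _ hU =>
      (saturation_subset_iff hU.1).2 ((saturation_subset_iff hU.1).2 hU.2))
    (Set.subset_iInter₂ fun _ hV => hV.2)

theorem repClosure_repClosure {X : Type*} (δX : CantorRep X) (A : Set X) :
    repClosure δX (repClosure δX A) = repClosure δX A :=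
  Set.Subset.antisymm
    (Set.subset_iInter₂ fun _ hU =>
      (repClosure_subset_iff hU.1).2 ((repClosure_subset_iff hU.1).2 hU.2))
    (Set.subset_iInter₂ fun _ hV => hV.2)

theorem containingFamily_saturation {X : Type*} (δX : CantorRep X) (A : Set X) :
    containingFamily δX (saturation δX A) = containingFamily δX A :=
  Set.ext fun U => saturation_subset_iff U.2

theorem intersectingFamily_repClosure {X : Type*} (δX : CantorRep X) (A : Set X) :
    intersectingFamily δX (repClosure δX A) = intersectingFamily δX A :=
  Set.ext fun U => repClosure_inter_nonempty_iff U.2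

/-- Saturation is computable as a map into `𝒦(X)` if and only if the family of open supersets is
computable as a map into `𝒪(𝒪(X))`. -/
theorem computableInto_saturation_iff {X Z : Type*} {δX : CantorRep X} {δZ : CantorRep Z}
    {A : Z → Set X} : ComputableInto δZ (compactRep δX) (fun z => saturation δX (A z)) ↔
      ComputableInto δZ (openRep (openRep δX)) fun z => containingFamily δX (A z) := by
  -- Now both sides concern the same names, since a name of a set in `𝒦(X)` is by definition a name
  -- of its family; the same realizer serves.
  simp only [← containingFamily_saturation δX (A _)]
  exact ⟨fun ⟨h, h'⟩ => ⟨fun z => (h z).2, h'⟩,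
    fun ⟨h, h'⟩ => ⟨fun z => ⟨saturation_saturation δX _, h z⟩, h'⟩⟩

/-- Closure is computable as a map into `𝒱(X)` if and only if the family of the intersecting open
sets is computable as a map into `𝒪(𝒪(X))`. -/
theorem computableInto_repClosure_iff {X Z : Type*} {δX : CantorRep X} {δZ : CantorRep Z}
    {A : Z → Set X} : ComputableInto δZ (overtRep δX) (fun z => repClosure δX (A z)) ↔
      ComputableInto δZ (openRep (openRep δX)) fun z => intersectingFamily δX (A z) := by
  simp only [← intersectingFamily_repClosure δX (A _)]
  exact ⟨fun ⟨h, h'⟩ => ⟨fun z => (h z).2, h'⟩,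
    fun ⟨h, h'⟩ => ⟨fun z => ⟨repClosure_repClosure δX _, h z⟩, h'⟩⟩

/-! ### Quantifiers -/

/-- By definition, `y ∈ forallSet R A` says that the section of `R` at `y` contains `A`. -/
theorem forallComputable_of_containingFamily {X Y : Type*} {δX : CantorRep X} (δY : CantorRep Y)
    {𝒮 : Set (Set X)} {δS : CantorRep 𝒮}
    (h : ComputableInto δS (openRep (openRep δX)) fun A => containingFamily δX A.1) :
    ForallComputable δX δY δS :=
  computableInto_sections_mem h.2

theorem existsComputable_of_intersectingFamily {X Y : Type*} {δX : CantorRep X} (δY : CantorRep Y)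
    {𝒮 : Set (Set X)} {δS : CantorRep 𝒮}
    (h : ComputableInto δS (openRep (openRep δX)) fun A => intersectingFamily δX A.1) :
    ExistsComputable δX δY δS :=
  computableInto_sections_mem h.2

theorem computableInto_containingFamily_compactRep {X : Type*} (δX : CantorRep X) :
    ComputableInto (compactRep δX) (openRep (openRep δX)) fun K => containingFamily δX K.1 := by
  obtain ⟨c, hc⟩ := Machine.exists_outputs_self
  exact ⟨fun K => K.2.2, c, fun p K hp => ⟨p, hc p, hp⟩⟩

theorem computableInto_intersectingFamily_overtRep {X : Type*} (δX : CantorRep X) :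
    ComputableInto (overtRep δX) (openRep (openRep δX)) fun A => intersectingFamily δX A.1 := by
  obtain ⟨c, hc⟩ := Machine.exists_outputs_self
  exact ⟨fun A => A.2.2, c, fun p A hp => ⟨p, hc p, hp⟩⟩

theorem proposition39 {X : Type*} {Y : Type*} (δX : CantorRep X) (δY : CantorRep Y) :
    (ForallComputable δX δY (compactRep δX) ∧ ExistsComputable δX δY (overtRep δX)) ∧
    ∀ (𝒮 : Set (Set X)) (δS : CantorRep 𝒮), (∃ y₀ : Y, ComputablePoint δY y₀) →
      (ForallComputable δX δY δS ↔
        ComputableInto δS (compactRep δX) fun A => saturation δX A.1) ∧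
      (ExistsComputable δX δY δS ↔
        ComputableInto δS (overtRep δX) fun A => repClosure δX A.1) := by
  refine ⟨⟨forallComputable_of_containingFamily δY (computableInto_containingFamily_compactRep δX),
    existsComputable_of_intersectingFamily δY (computableInto_intersectingFamily_overtRep δX)⟩,
    ?_⟩
  rintro 𝒮 δS ⟨y₀, hy₀⟩
  rw [computableInto_saturation_iff, computableInto_repClosure_iff]
  refine ⟨⟨fun h => computableInto_family h hy₀ ?_, forallComputable_of_containingFamily δY⟩,
    ⟨fun h => computableInto_family h hy₀ ?_, existsComputable_of_intersectingFamily δY⟩⟩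
  -- Over a cylinder the condition at `y₀` no longer depends on `y₀` and reads `A ⊆ U`.
  · intro A U R hR
    simp only [forallSet, hR]
    exact Iff.rfl
  · intro A U R hR
    simp only [existsSet, hR]
    exact Iff.rfl
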